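/- Let $K\in\mathbb{R}$. There is $\delta>0$, depending only on $K$, such that the following holds. Let $X$ be a Banach space, let $\cdots<t_{-1}<t_0=0<t_1<\cdots$ be real numbers with $t_k\to\pm\infty$ as $k\to\pm\infty$, let $\widetilde A:\mathbb{R}\to\mathscr{B}(X)$, $B_i\in\mathscr{B}(X)$ ($i\in\mathbb{Z}$) and $f:\mathbb{R}\times X\to X$, and consider the linear and the nonlinear impulsive equations $$\dot x(t)=\widetilde A(t)x(t)\ \ (t\ne t_i),\qquad x(t_i^+)-x(t_i)=B_ix(t_i)\ \ (i\in\mathbb{Z}),\tag{L}$$ $$\dot x(t)=\widetilde A(t)x(t)+f(t,x(t))\ \ (t\ne t_i),\qquad x(t_i^+)-x(t_i)=B_ix(t_i)\ \ (i\in\mathbb{Z}).\tag{N}$$ Integrals of $\widetilde A$, of $f$ and in the notion of solution are Perron (Henstock–Kurzweil) integrals, and a solution of (N) is a function $x:\mathbb{R}\to X$ such that, for all $s\le t$, the integrals below exist and $$x(t)=x(s)+\int_s^t\widetilde A(r)x(r)\,dr+\int_s^t f(r,x(r))\,dr+\sum_{s\le t_i<t}B_ix(t_i);$$ solutions of (L)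 are defined by taking $f=0$. Assume: 1. $\widetilde A$ is Perron integrable on every compact interval, and there is a locally Lebesgue integrable $m_0:\mathbb{R}\to\mathbb{R}$ with $\left\|\int_c^d\widetilde A(s)\,ds\right\|\le\int_c^d m_0(s)\,ds$ for all $c<d$. 2. (L) has an exponential dichotomy on $\mathbb{R}$ with constant $K$: $K>0$, and there are a bounded projection $P$ on $X$ and $\alpha>0$ such that the evolution operator $W(t,s)\in\mathscr{B}(X)$ of (L) (so $t\mapsto W(t,s)\xi$ is the solution of (L) with value $\xi$ at time $s$) satisfies $$\|W(t,0)PW(0,s)\|\le Ke^{-\alpha(t-s)}\ (t\ge s),\qquad \|W(t,0)(I-P)W(0,s)\|\le Ke^{\alpha(t-s)}\ (t<s).$$ 3. There is a constant $C_b$ such that $\sum_{i\in\mathbb{Z}}\|B_i\|\le C_b$ and, for every $i$, $I+B_i$ is invertible in $\mathscr{B}(X)$ with $\|(I+B_i)^{-1}\|\le C_b$. 4. The integral $\int_{\mathbb{R}}\widetilde A(s)\,ds$ exists (as the limit of $\int_c^d\widetilde A(s)\,ds$ for $c\to-\infty$, $d\to\infty$), and $\left\|\int_{\mathbb{R}}\widetilde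 A(s)\,ds\right\|\le\int_{\mathbb{R}}m(s)\,ds$ for some Lebesgue integrable $m:\mathbb{R}\to\mathbb{R}$. 5. For every $x\in X$ the function $f(\cdot,x)$ is Perron integrable on every compact interval; $f(t,0)=0$ for all $t$; and there is a Lebesgue integrable $\gamma:\mathbb{R}\to\mathbb{R}$ with $\|f(t,x)\|\le\gamma(t)$ and $\|f(t,x)-f(t,y)\|\le\gamma(t)\|x-y\|$ for all $t\in\mathbb{R}$ and $x,y\in X$. If $\int_{\mathbb{R}}\gamma(s)\,ds<\delta$, then (N) has exactly one solution that is bounded on $\mathbb{R}$. -/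

import Mathlib

open Set Filter Topology MeasureTheory

namespace ImpulsiveODE

/-- A tagged division of `[a, b]`: finitely many points `a = s 0 ≤ s 1 ≤ ⋯ ≤ s n = b` with tags
`τ j ∈ [s j, s (j + 1)]`, `j < n`. The values of `s` beyond `n` and of `τ` from `n` on are
irrelevant. -/
structure TaggedDivision (a b : ℝ) where
  /-- the number of subintervals -/
  n : ℕ
  /-- the division points -/
  s : ℕ → ℝ
  /-- the tags -/
  τ : ℕ → ℝ
  start : s 0 = a
  finish : s n = b
  tag_mem : ∀ j < n, τ j ∈ Icc (s j) (s (j + 1))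

/-- The division is fine for the gauge `δ`. -/
def TaggedDivision.IsFine {a b : ℝ} (D : TaggedDivision a b) (δ : ℝ → ℝ) : Prop :=
  ∀ j < D.n, Icc (D.s j) (D.s (j + 1)) ⊆ Ioo (D.τ j - δ (D.τ j)) (D.τ j + δ (D.τ j))

section Integral

variable {E : Type*} [NormedAddCommGroup E] [NormedSpace ℝ E]

/-- `J` is the Kurzweil integral `∫_a^b DV(τ, t)` (with `a ≤ b`): the sums
`∑ (V(τ_j, s_{j+1}) - V(τ_j, s_j))` over tagged divisions converge to `J` in the sense of gauges. -/
def HasKurzweilIntegral (V : ℝ → ℝ → E) (a b : ℝ) (J : E) : Prop :=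
  a ≤ b ∧ ∀ ε > 0, ∃ δ : ℝ → ℝ, (∀ t, 0 < δ t) ∧ ∀ D : TaggedDivision a b, D.IsFine δ →
    ‖∑ j ∈ Finset.range D.n, (V (D.τ j) (D.s (j + 1)) - V (D.τ j) (D.s j)) - J‖ < ε

/-- `J` is the Perron (Henstock-Kurzweil) integral `∫_a^b g(r) dr`, that is, the Kurzweil integral
of `V(τ, t) = t g(τ)`. -/
def HasPerronIntegral (g : ℝ → E) (a b : ℝ) (J : E) : Prop :=
  HasKurzweilIntegral (fun τ t => t • g τ) a b J

/-- `g` is Perron integrable on `[a, b]`. -/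
def PerronIntegrable (g : ℝ → E) (a b : ℝ) : Prop :=
  ∃ J, HasPerronIntegral g a b J

/-- `J` is the Perron integral of `g` over the whole line: the limit of the Perron integrals over
`[c, d]` as `c → -∞` and `d → ∞`. -/
def HasPerronIntegralReal (g : ℝ → E) (J : E) : Prop :=
  ∃ F : ℝ → ℝ → E, (∀ c d, c ≤ d → HasPerronIntegral g c d (F c d)) ∧
    Tendsto (fun p : ℝ × ℝ => F p.1 p.2) (atBot ×ˢ atTop) (𝓝 J)

end Integral

/-- Impulse times `⋯ < θ (-1) < θ 0 = 0 < θ 1 < ⋯` with `θ k → ±∞` as `k → ±∞`. -/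
structure IsImpulseSequence (θ : ℤ → ℝ) : Prop where
  strictMono : StrictMono θ
  zero : θ 0 = 0
  tendsto_atTop : Tendsto θ atTop atTop
  tendsto_atBot : Tendsto θ atBot atBot

variable {X : Type*} [NormedAddCommGroup X] [NormedSpace ℝ X]

/-- `x : ℝ → X` solves `x' = A(t) x + f(t, x)` for `t ≠ θ i`, `x(θ i +) - x(θ i) = B i (x (θ i))`:
for all `s ≤ t`,
`x(t) = x(s) + ∫_s^t A(r) x(r) dr + ∫_s^t f(r, x(r)) dr + ∑_{s ≤ θ i < t} B i (x (θ i))`,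
with both integrals existing as Perron integrals. (The sum is finite when `θ` is an impulse
sequence.) -/
def IsSolution (A : ℝ → X →L[ℝ] X) (θ : ℤ → ℝ) (B : ℤ → X →L[ℝ] X) (f : ℝ → X → X)
    (x : ℝ → X) : Prop :=
  ∀ s t, s ≤ t → ∃ J₁ J₂ : X,
    HasPerronIntegral (fun r => A r (x r)) s t J₁ ∧
    HasPerronIntegral (fun r => f r (x r)) s t J₂ ∧
    x t = x s + J₁ + J₂ + ∑ᶠ (i : ℤ) (_ : s ≤ θ i ∧ θ i < t), B i (x (θ i))

/-- `x` solves the linear impulsive equation `x' = A(t) x` for `t ≠ θ i`,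
`x(θ i +) - x(θ i) = B i (x (θ i))`. -/
def IsLinearSolution (A : ℝ → X →L[ℝ] X) (θ : ℤ → ℝ) (B : ℤ → X →L[ℝ] X) (x : ℝ → X) : Prop :=
  IsSolution A θ B (fun _ _ => 0) x

/-- `W` is the evolution operator of the linear impulsive equation: `t ↦ W t s ξ` is the solution
with value `ξ` at time `s`. -/
def IsEvolutionOperator (A : ℝ → X →L[ℝ] X) (θ : ℤ → ℝ) (B : ℤ → X →L[ℝ] X)
    (W : ℝ → ℝ → X →L[ℝ] X) : Prop :=
  ∀ (s : ℝ) (ξ : X), W s s ξ = ξ ∧ IsLinearSolution A θ B (fun t => W t s ξ)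

/-- The linear impulsive equation has an exponential dichotomy on `ℝ` with projection `P` and
constants `K`, `α`; here `W t 0` is the fundamental operator and `W 0 s` the inverse of `W s 0`. -/
def HasExponentialDichotomy (A : ℝ → X →L[ℝ] X) (θ : ℤ → ℝ) (B : ℤ → X →L[ℝ] X)
    (P : X →L[ℝ] X) (K α : ℝ) : Prop :=
  0 < K ∧ 0 < α ∧ P ∘L P = P ∧ ∃ W : ℝ → ℝ → X →L[ℝ] X, IsEvolutionOperator A θ B W ∧
    (∀ t s, s ≤ t → ‖W t 0 ∘L P ∘L W 0 s‖ ≤ K * Real.exp (-α * (t - s))) ∧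
    (∀ t s, t < s →
      ‖W t 0 ∘L (ContinuousLinearMap.id ℝ X - P) ∘L W 0 s‖ ≤ K * Real.exp (α * (t - s)))

end ImpulsiveODE

namespace ImpulsiveODE

/-! Since `f t 0 = 0`, the zero function is a bounded solution, so only uniqueness is at stake. Let
`x` be a bounded solution with `N = sup ‖x‖`. For fixed `t` the operators `Q s = W t 0 ∘ P ∘ W 0 s`
satisfy `Q s ∘ W s r = Q r`, so `Q s (x s)` changes only through the nonlinearity. Following it from
`-∞` to `t`, and its analogue for `I - P` back from `+∞`, the dichotomy removes the contribution of
the far end and leaves `‖x t‖ ≤ 4 K ∫ γ N` (`norm_le_of_bounded_solution`). Hence `N ≤ 4 K (∫ γ) N`,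
and `N = 0` if `∫ γ` is small.

No variation of constants formula for Perron integrals is needed. On a short interval `x` is
compared with the linear solution through its left end (`exists_local_estimates`), and Cousin's
lemma adds up the local bounds (`norm_sub_le_of_invariant`). The factor 2 lost locally does not
accumulate, because each comparison starts afresh and `‖Q s‖ ≤ K` uniformly.

The analytic core is `‖∫ A z‖ ≤ sup ‖z‖ ∫ |m|` for continuous `z`
(`HasPerronIntegral.norm_le_mul_integral`), although only integrals of `A` are controlled. It rests
on the Saks-Henstock lemma and on a comparison of Perron with Lebesgue integrals. -/

/-- Cousin's lemma as an induction principle for relations between points of `[a, b]`. -/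
theorem cousin_induction {a b : ℝ} (hab : a ≤ b) (R : ℝ → ℝ → Prop)
    (trans : ∀ s t u, a ≤ s → s ≤ t → t ≤ u → u ≤ b → R s t → R t u → R s u)
    (loc : ∀ p ∈ Icc a b, ∃ δ > 0, ∀ s t, a ≤ s → s ≤ p → p ≤ t → t ≤ b →
      p - δ < s → t < p + δ → R s t) : R a b := by
  set S : Set ℝ := {x | x ∈ Icc a b ∧ R a x} with hS
  have haS : a ∈ S := by
    obtain ⟨δ, hδ, h⟩ := loc a ⟨le_rfl, hab⟩
    exact ⟨⟨le_rfl, hab⟩, h a a le_rfl le_rfl le_rfl hab (by linarith) (by linarith)⟩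
  have hbdd : BddAbove S := ⟨b, fun x hx => hx.1.2⟩
  set c := sSup S with hc
  have hac : a ≤ c := le_csSup hbdd haS
  have hcb : c ≤ b := csSup_le ⟨a, haS⟩ fun x hx => hx.1.2
  obtain ⟨δ, hδ, h⟩ := loc c ⟨hac, hcb⟩
  obtain ⟨s, hsS, hs⟩ := exists_lt_of_lt_csSup ⟨a, haS⟩ (show c - δ < sSup S by linarith)
  have hsc : s ≤ c := le_csSup hbdd hsS
  have key : ∀ t, c ≤ t → t ≤ b → t < c + δ → R a t := fun t h1 h2 h3 =>
    trans a s t le_rfl hsS.1.1 (hsc.trans h1) h2 hsS.2 (h s t hsS.1.1 hsc h1 h2 hs h3)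
  rcases hcb.eq_or_lt with heq | hlt
  · exact key b hcb le_rfl (by linarith)
  · have hm : c < min b (c + δ / 2) := lt_min hlt (by linarith)
    have : min b (c + δ / 2) ∈ S :=
      ⟨⟨by linarith, min_le_left _ _⟩, key _ hm.le (min_le_left _ _)
        (by linarith [min_le_right b (c + δ / 2)])⟩
    linarith [le_csSup hbdd this]

/-! ### Riemann sums, elementary properties of the Perron integral, Saks-Henstock lemma -/

section Sums

variable {E : Type*} [NormedAddCommGroup E] [NormedSpace ℝ E]

/-- `S` is a Riemann sum of `g` over a tagged division of `[a, b]` that is fine for `δ`. -/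
inductive FineSum (g : ℝ → E) (δ : ℝ → ℝ) (a : ℝ) : ℝ → E → Prop
  | nil : FineSum g δ a a 0
  | snoc {c d τ : ℝ} {S : E} (h : FineSum g δ a c S) (h₁ : c ≤ τ) (h₂ : τ ≤ d)
      (h₃ : τ - δ τ < c) (h₄ : d < τ + δ τ) : FineSum g δ a d (S + (d - c) • g τ)

theorem FineSum.le {g : ℝ → E} {δ : ℝ → ℝ} {a b : ℝ} {S : E} (h : FineSum g δ a b S) :
    a ≤ b := by
  induction h with
  | nil => exact le_rfl
  | snoc h h₁ h₂ h₃ h₄ ih => linarith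

theorem FineSum.append {g : ℝ → E} {δ : ℝ → ℝ} {a b c : ℝ} {S T : E} (h : FineSum g δ a b S)
    (h' : FineSum g δ b c T) : FineSum g δ a c (S + T) := by
  induction h' with
  | nil => simpa using h
  | snoc _ h₁ h₂ h₃ h₄ ih => rw [← add_assoc]; exact ih.snoc h₁ h₂ h₃ h₄

theorem FineSum.mono {g : ℝ → E} {δ δ' : ℝ → ℝ} (hδ : ∀ t, δ t ≤ δ' t) {a b : ℝ} {S : E}
    (h : FineSum g δ a b S) : FineSum g δ' a b S := by
  induction h with
  | nil => exact .nil
  | @snoc c d τ S _ h₁ h₂ h₃ h₄ ih =>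
    exact ih.snoc h₁ h₂ (by linarith [hδ τ]) (by linarith [hδ τ])

theorem exists_fineSum (g : ℝ → E) {δ : ℝ → ℝ} (hδ : ∀ t, 0 < δ t) {a b : ℝ} (hab : a ≤ b) :
    ∃ S, FineSum g δ a b S := by
  refine cousin_induction hab (fun c d => ∃ S, FineSum g δ c d S) ?_ ?_
  · rintro s t u - - - - ⟨S, hS⟩ ⟨T, hT⟩
    exact ⟨S + T, hS.append hT⟩
  · intro p _
    exact ⟨δ p, hδ p, fun s t _ h₁ h₂ _ h₃ h₄ => ⟨_, FineSum.nil.snoc h₁ h₂ h₃ h₄⟩⟩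

theorem TaggedDivision.fineSum {g : ℝ → E} {δ : ℝ → ℝ} {a b : ℝ} (D : TaggedDivision a b)
    (hD : D.IsFine δ) : FineSum g δ a b
      (∑ j ∈ Finset.range D.n, (D.s (j + 1) • g (D.τ j) - D.s j • g (D.τ j))) := by
  have key : ∀ k ≤ D.n, FineSum g δ a (D.s k)
      (∑ j ∈ Finset.range k, (D.s (j + 1) • g (D.τ j) - D.s j • g (D.τ j))) := by
    intro k
    induction k with
    | zero => intro _; rw [D.start]; exact .nil
    | succ k ih =>
      intro hk
      rw [Finset.sum_range_succ, ← sub_smul]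
      have ht := D.tag_mem k hk
      have hle := ht.1.trans ht.2
      exact (ih (by omega)).snoc ht.1 ht.2 (hD k hk (left_mem_Icc.2 hle)).1
        (hD k hk (right_mem_Icc.2 hle)).2
  simpa [D.finish] using key D.n le_rfl

theorem FineSum.exists_taggedDivision {g : ℝ → E} {δ : ℝ → ℝ} {a b : ℝ} {S : E}
    (h : FineSum g δ a b S) : ∃ D : TaggedDivision a b, D.IsFine δ ∧
      ∑ j ∈ Finset.range D.n, (D.s (j + 1) • g (D.τ j) - D.s j • g (D.τ j)) = S := by
  induction h with
  | nil => exact ⟨⟨0, fun _ => a, fun _ => a, rfl, rfl, by simp⟩, fun j hj => by simp at hj, by simp⟩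
  | @snoc c d τ S _ h₁ h₂ h₃ h₄ ih =>
    obtain ⟨D, hD, rfl⟩ := ih
    have hs : ∀ j < D.n, (if j + 1 ≤ D.n then D.s (j + 1) else d) = D.s (j + 1) :=
      fun j hj => if_pos hj
    refine ⟨⟨D.n + 1, fun j => if j ≤ D.n then D.s j else d,
      fun j => if j < D.n then D.τ j else τ, by simp [D.start], by simp, ?_⟩, ?_, ?_⟩
    · intro j hj
      rcases (Nat.lt_succ_iff.1 hj).lt_or_eq with h | rfl
      · simpa [h, h.le, Nat.succ_le_of_lt h] using D.tag_mem j h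
      · simpa [D.finish] using ⟨h₁, h₂⟩
    · intro j hj
      rcases (Nat.lt_succ_iff.1 hj).lt_or_eq with h | rfl
      · simpa [h, h.le, Nat.succ_le_of_lt h] using hD j h
      · simp only [le_refl, if_true, D.finish, lt_irrefl, if_false]
        rw [if_neg (by omega)]
        exact fun r hr => ⟨h₃.trans_le hr.1, hr.2.trans_lt h₄⟩
    · dsimp only
      rw [Finset.sum_range_succ]
      congr 1
      · refine Finset.sum_congr rfl fun j hj => ?_
        have h := Finset.mem_range.1 hj
        simp [h, h.le, Nat.succ_le_of_lt h]
      · simp [D.finish, sub_smul]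

/-- Fine sums, built one interval at a time, allow induction in place of index arithmetic on
divisions. -/
theorem hasPerronIntegral_iff {g : ℝ → E} {a b : ℝ} {J : E} :
    HasPerronIntegral g a b J ↔ a ≤ b ∧ ∀ ε > 0, ∃ δ : ℝ → ℝ, (∀ t, 0 < δ t) ∧
      ∀ S, FineSum g δ a b S → ‖S - J‖ < ε := by
  refine and_congr_right fun _ => forall₂_congr fun ε _ => exists_congr fun δ =>
    and_congr_right fun _ => ⟨fun h S hS => ?_, fun h D hD => h _ (D.fineSum hD)⟩
  obtain ⟨D, hD, rfl⟩ := hS.exists_taggedDivision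
  exact h D hD

theorem HasPerronIntegral.le {g : ℝ → E} {a b : ℝ} {J : E} (h : HasPerronIntegral g a b J) :
    a ≤ b := h.1

theorem HasPerronIntegral.exists_gauge {g : ℝ → E} {a b : ℝ} {J : E}
    (h : HasPerronIntegral g a b J) {ε : ℝ} (hε : 0 < ε) : ∃ δ : ℝ → ℝ, (∀ t, 0 < δ t) ∧
      ∀ S, FineSum g δ a b S → ‖S - J‖ < ε :=
  (hasPerronIntegral_iff.1 h).2 ε hε

/-- Fine sums that are close to the integral exist for every gauge. -/
theorem HasPerronIntegral.exists_fineSum {g : ℝ → E} {a b : ℝ} {J : E}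
    (h : HasPerronIntegral g a b J) {δ : ℝ → ℝ} (hδ : ∀ t, 0 < δ t) {ε : ℝ} (hε : 0 < ε) :
    ∃ S, FineSum g δ a b S ∧ ‖S - J‖ < ε := by
  obtain ⟨δ', hδ', h'⟩ := h.exists_gauge hε
  obtain ⟨S, hS⟩ := ImpulsiveODE.exists_fineSum g (δ := fun t => min (δ t) (δ' t))
    (fun t => lt_min (hδ t) (hδ' t)) h.le
  exact ⟨S, hS.mono fun t => min_le_left _ _, h' S (hS.mono fun t => min_le_right _ _)⟩

theorem HasPerronIntegral.unique {g : ℝ → E} {a b : ℝ} {J J' : E}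
    (h : HasPerronIntegral g a b J) (h' : HasPerronIntegral g a b J') : J = J' := by
  refine eq_of_forall_dist_le fun ε hε => ?_
  obtain ⟨δ, hδ, hJ⟩ := h.exists_gauge (half_pos hε)
  obtain ⟨S, hS, hS'⟩ := h'.exists_fineSum hδ (half_pos hε)
  have e : J - J' = (S - J') - (S - J) := by abel
  rw [dist_eq_norm, e]
  linarith [norm_sub_le (S - J') (S - J), hJ S hS]

/-- As the integral over `[a, c]` is assumed to exist, one gauge for it suffices: concatenated fine
sums for the two pieces are fine sums for the whole. -/
theorem HasPerronIntegral.add_adjacent {g : ℝ → E} {a b c : ℝ} {J₁ J₂ J : E}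
    (h₁ : HasPerronIntegral g a b J₁) (h₂ : HasPerronIntegral g b c J₂)
    (h : HasPerronIntegral g a c J) : J = J₁ + J₂ := by
  refine eq_of_forall_dist_le fun ε hε => ?_
  obtain ⟨δ, hδ, hJ⟩ := h.exists_gauge (ε := ε / 3) (by linarith)
  obtain ⟨S, hS, hS'⟩ := h₁.exists_fineSum hδ (ε := ε / 3) (by linarith)
  obtain ⟨T, hT, hT'⟩ := h₂.exists_fineSum hδ (ε := ε / 3) (by linarith)
  have := hJ _ (hS.append hT)
  rw [dist_eq_norm]
  have e : J - (J₁ + J₂) = (S - J₁) + (T - J₂) - (S + T - J) := by abel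
  rw [e]
  linarith [norm_sub_le ((S - J₁) + (T - J₂)) (S + T - J), norm_add_le (S - J₁) (T - J₂)]

theorem HasPerronIntegral.congr {g g' : ℝ → E} {a b : ℝ} {J : E}
    (h : HasPerronIntegral g a b J) (hg : ∀ t, g t = g' t) : HasPerronIntegral g' a b J :=
  (funext hg : g = g') ▸ h

variable {F : Type*} [NormedAddCommGroup F] [NormedSpace ℝ F]

theorem FineSum.of_clm {g : ℝ → E} {δ : ℝ → ℝ} {a b : ℝ} (Λ : E →L[ℝ] F) {S : F}
    (h : FineSum (fun t => Λ (g t)) δ a b S) : ∃ T, FineSum g δ a b T ∧ S = Λ T := by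
  induction h with
  | nil => exact ⟨0, .nil, by simp⟩
  | snoc _ h₁ h₂ h₃ h₄ ih =>
    obtain ⟨T, hT, rfl⟩ := ih
    exact ⟨_, hT.snoc h₁ h₂ h₃ h₄, by simp⟩

theorem HasPerronIntegral.clm {g : ℝ → E} {a b : ℝ} {J : E} (h : HasPerronIntegral g a b J)
    (Λ : E →L[ℝ] F) : HasPerronIntegral (fun t => Λ (g t)) a b (Λ J) := by
  refine hasPerronIntegral_iff.2 ⟨h.le, fun ε hε => ?_⟩
  have hp : 0 < ‖Λ‖ + 1 := by positivity
  obtain ⟨δ, hδ, h'⟩ := h.exists_gauge (div_pos hε hp)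
  refine ⟨δ, hδ, fun S hS => ?_⟩
  obtain ⟨T, hT, rfl⟩ := hS.of_clm
  rw [← map_sub]
  have h1 := h' T hT
  rw [lt_div_iff₀ hp] at h1
  nlinarith [Λ.le_opNorm (T - J), norm_nonneg (T - J)]

theorem FineSum.of_sub {g g' : ℝ → E} {δ : ℝ → ℝ} {a b : ℝ} {S : E}
    (h : FineSum (fun t => g t - g' t) δ a b S) :
    ∃ T T', FineSum g δ a b T ∧ FineSum g' δ a b T' ∧ S = T - T' := by
  induction h with
  | nil => exact ⟨0, 0, .nil, .nil, by simp⟩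
  | snoc _ h₁ h₂ h₃ h₄ ih =>
    obtain ⟨T, T', hT, hT', rfl⟩ := ih
    refine ⟨_, _, hT.snoc h₁ h₂ h₃ h₄, hT'.snoc h₁ h₂ h₃ h₄, ?_⟩
    rw [smul_sub]; abel

theorem HasPerronIntegral.sub {g g' : ℝ → E} {a b : ℝ} {J J' : E}
    (h : HasPerronIntegral g a b J) (h' : HasPerronIntegral g' a b J') :
    HasPerronIntegral (fun t => g t - g' t) a b (J - J') := by
  refine hasPerronIntegral_iff.2 ⟨h.le, fun ε hε => ?_⟩
  obtain ⟨δ, hδ, H⟩ := h.exists_gauge (half_pos hε)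
  obtain ⟨δ', hδ', H'⟩ := h'.exists_gauge (half_pos hε)
  refine ⟨fun t => min (δ t) (δ' t), fun t => lt_min (hδ t) (hδ' t), fun S hS => ?_⟩
  obtain ⟨T, T', hT, hT', rfl⟩ := hS.of_sub
  have e : T - T' - (J - J') = (T - J) - (T' - J') := by abel
  rw [e]
  linarith [norm_sub_le (T - J) (T' - J'), H T (hT.mono fun t => min_le_left _ _),
    H' T' (hT'.mono fun t => min_le_right _ _)]

theorem hasPerronIntegral_zero {a b : ℝ} (hab : a ≤ b) :
    HasPerronIntegral (fun _ => (0 : E)) a b 0 := by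
  refine hasPerronIntegral_iff.2 ⟨hab, fun ε hε => ⟨fun _ => 1, fun _ => one_pos, fun S hS => ?_⟩⟩
  have : S = 0 := by
    clear hab
    induction hS with
    | nil => rfl
    | snoc _ _ _ _ _ ih => simp [ih]
  simpa [this] using hε

/-- `S` is the sum of the errors `(d - c) g(τ) - ∫_c^d g` over some of the intervals `[c, d]` of a
division of `[a, b]`, with tags that are fine for `δ`. -/
inductive FineError (g : ℝ → E) (δ : ℝ → ℝ) (a : ℝ) : ℝ → E → Prop
  | nil : FineError g δ a a 0
  | skip {c d : ℝ} {S : E} (h : FineError g δ a c S) (h₁ : c ≤ d) : FineError g δ a d S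
  | snoc {c d τ : ℝ} {S J : E} (h : FineError g δ a c S) (h₁ : c ≤ τ) (h₂ : τ ≤ d)
      (h₃ : τ - δ τ < c) (h₄ : d < τ + δ τ) (hJ : HasPerronIntegral g c d J) :
      FineError g δ a d (S + ((d - c) • g τ - J))

theorem FineError.le {g : ℝ → E} {δ : ℝ → ℝ} {a b : ℝ} {S : E} (h : FineError g δ a b S) :
    a ≤ b := by
  induction h with
  | nil => exact le_rfl
  | skip h h₁ ih => linarith
  | snoc h h₁ h₂ h₃ h₄ _ ih => linarith

theorem FineError.append {g : ℝ → E} {δ : ℝ → ℝ} {a b c : ℝ} {S T : E}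
    (h : FineError g δ a b S) (h' : FineError g δ b c T) : FineError g δ a c (S + T) := by
  induction h' with
  | nil => simpa using h
  | skip _ h₁ ih => exact ih.skip h₁
  | snoc _ h₁ h₂ h₃ h₄ hJ ih => rw [← add_assoc]; exact ih.snoc h₁ h₂ h₃ h₄ hJ

theorem FineError.mono {g : ℝ → E} {δ δ' : ℝ → ℝ} (hδ : ∀ t, δ t ≤ δ' t) {a b : ℝ} {S : E}
    (h : FineError g δ a b S) : FineError g δ' a b S := by
  induction h with
  | nil => exact .nil
  | skip _ h₁ ih => exact ih.skip h₁
  | @snoc c d τ S J _ h₁ h₂ h₃ h₄ hJ ih =>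
    exact ih.snoc h₁ h₂ (by linarith [hδ τ]) (by linarith [hδ τ]) hJ

/-- Filling each skipped interval with a fine sum very close to its integral makes a partial
division complete, at a total cost below any `η`. -/
theorem FineError.exists_fineSum {g : ℝ → E} {a b : ℝ}
    (hg : ∀ c d, a ≤ c → c ≤ d → d ≤ b → PerronIntegrable g c d) {δ : ℝ → ℝ}
    (hδ : ∀ t, 0 < δ t) {d : ℝ} {S : E} (h : FineError g δ a d S) :
    d ≤ b → ∀ J, HasPerronIntegral g a d J → ∀ η > 0,
      ∃ T, FineSum g δ a d T ∧ ‖T - J - S‖ < η := by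
  induction h with
  | nil =>
    intro _ J hJ η hη
    obtain ⟨T, hT, hT'⟩ := hJ.exists_fineSum hδ hη
    exact ⟨T, hT, by simpa using hT'⟩
  | @skip c d S h h₁ ih =>
    intro hd J hJ η hη
    obtain ⟨J₁, hJ₁⟩ := hg a c le_rfl h.le (h₁.trans hd)
    obtain ⟨J₂, hJ₂⟩ := hg c d h.le h₁ hd
    obtain ⟨T, hT, hT'⟩ := ih (h₁.trans hd) J₁ hJ₁ (η / 2) (by linarith)
    obtain ⟨U, hU, hU'⟩ := hJ₂.exists_fineSum hδ (half_pos hη)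
    refine ⟨T + U, hT.append hU, ?_⟩
    have e : T + U - J - S = (T - J₁ - S) + (U - J₂) := by
      rw [hJ₁.add_adjacent hJ₂ hJ]; abel
    rw [e]
    linarith [norm_add_le (T - J₁ - S) (U - J₂)]
  | @snoc c d τ S J' h h₁ h₂ h₃ h₄ hJ' ih =>
    intro hd J hJ η hη
    have h₁₂ := h₁.trans h₂
    obtain ⟨J₁, hJ₁⟩ := hg a c le_rfl h.le (h₁₂.trans hd)
    obtain ⟨T, hT, hT'⟩ := ih (h₁₂.trans hd) J₁ hJ₁ η hη
    refine ⟨_, hT.snoc h₁ h₂ h₃ h₄, ?_⟩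
    have e : T + (d - c) • g τ - J - (S + ((d - c) • g τ - J')) = T - J₁ - S := by
      rw [hJ₁.add_adjacent hJ' hJ]; abel
    rwa [e]

/-- The Saks-Henstock lemma. -/
theorem exists_gauge_fineError {g : ℝ → E} {a b : ℝ} (hab : a ≤ b)
    (hg : ∀ c d, a ≤ c → c ≤ d → d ≤ b → PerronIntegrable g c d) {ε : ℝ} (hε : 0 < ε) :
    ∃ δ : ℝ → ℝ, (∀ t, 0 < δ t) ∧ ∀ S, FineError g δ a b S → ‖S‖ ≤ ε := by
  obtain ⟨J, hJ⟩ := hg a b le_rfl hab le_rfl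
  obtain ⟨δ, hδ, h⟩ := hJ.exists_gauge hε
  refine ⟨δ, hδ, fun S hS => le_of_forall_pos_le_add fun η hη => ?_⟩
  obtain ⟨T, hT, hT'⟩ := hS.exists_fineSum hg hδ le_rfl J hJ η hη
  have e : S = (T - J) - (T - J - S) := by abel
  rw [e]
  linarith [norm_sub_le (T - J) (T - J - S), h T hT]

/-- Continuity of the indefinite integral. -/
theorem exists_norm_integral_lt {g : ℝ → E} {a b : ℝ}
    (hg : ∀ c d, a ≤ c → c ≤ d → d ≤ b → PerronIntegrable g c d) {p : ℝ} (hp : p ∈ Icc a b)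
    {ε : ℝ} (hε : 0 < ε) : ∃ ρ > 0, ∀ c d J, a ≤ c → c ≤ p → p ≤ d → d ≤ b → p - ρ < c →
      d < p + ρ → HasPerronIntegral g c d J → ‖J‖ < ε := by
  obtain ⟨δ, hδ, h⟩ := exists_gauge_fineError (hp.1.trans hp.2) hg (half_pos hε)
  have hq : 0 < ‖g p‖ + 1 := by positivity
  refine ⟨min (δ p) (ε / 4 / (‖g p‖ + 1)), lt_min (hδ p) (by positivity), ?_⟩
  intro c d J hac hcp hpd hdb hc hd hJ
  have m1 := min_le_left (δ p) (ε / 4 / (‖g p‖ + 1))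
  have m2 := min_le_right (δ p) (ε / 4 / (‖g p‖ + 1))
  -- Saks-Henstock for the single interval `[c, d]` with tag `p`: `(d - c) g(p)` is within `ε / 2`
  -- of `J`.
  have := h _ (((FineError.nil.skip hac).snoc hcp hpd (by linarith) (by linarith) hJ).skip hdb)
  rw [zero_add] at this
  have hlt : d - c < 2 * (ε / 4 / (‖g p‖ + 1)) := by linarith
  have h1 : (d - c) * (‖g p‖ + 1) < ε / 2 := by
    calc _ < 2 * (ε / 4 / (‖g p‖ + 1)) * (‖g p‖ + 1) := by gcongr
      _ = ε / 2 := by field_simp; ring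
  have h2 : ‖(d - c) • g p‖ < ε / 2 ∨ d = c := by
    rcases (hcp.trans hpd).eq_or_lt with h | h
    · exact .inr h.symm
    · left
      rw [norm_smul, Real.norm_of_nonneg (by linarith)]
      nlinarith
  have h3 : ‖(d - c) • g p‖ < ε / 2 := by
    rcases h2 with h | h
    · exact h
    · simp [h, hε]
  have e : J = (d - c) • g p - ((d - c) • g p - J) := by abel
  rw [e]
  linarith [norm_sub_le ((d - c) • g p) ((d - c) • g p - J)]

end Sums

end ImpulsiveODE

/-! ### Comparison of Perron and Lebesgue integrals -/

namespace ImpulsiveODE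

/-- An integrable real function `φ` has an integrable majorant `u` whose integral is almost that
of `φ` and whose integrals dominate the terms of the Riemann sums of `φ` that are fine for some
gauge. -/
theorem exists_majorant {φ : ℝ → ℝ} (hφ : Integrable φ) {ε : ℝ} (hε : 0 < ε) :
    ∃ (u : ℝ → ℝ) (δ : ℝ → ℝ), Integrable u ∧
      (∀ a b, a ≤ b → ∫ t in a..b, φ t ≤ ∫ t in a..b, u t) ∧
      (∀ a b, a ≤ b → ∫ t in a..b, u t ≤ (∫ t in a..b, φ t) + ε) ∧
      (∀ t, 0 < δ t) ∧ ∀ c d τ, c ≤ τ → τ ≤ d → τ - δ τ < c → d < τ + δ τ →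
        (d - c) * φ τ ≤ ∫ t in c..d, u t := by
  -- Vitali-Carathéodory: a lower semicontinuous `g > φ` stays above `φ τ` near `τ`, and this
  -- neighbourhood is the gauge.
  obtain ⟨g, hlt, hsc, hint, htop, hg⟩ := exists_lt_lowerSemicontinuous_integral_lt φ hφ hε
  have hex : ∀ t, ∃ r > 0, ∀ s, |s - t| < r → (φ t : EReal) < g s := by
    intro t
    obtain ⟨r, hr, h⟩ := Metric.eventually_nhds_iff.1 (hsc t (φ t) (hlt t))
    exact ⟨r, hr, fun s hs => h (by rwa [Real.dist_eq])⟩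
  choose δ hδ hδ' using hex
  have hae : ∀ᵐ t, φ t ≤ (g t).toReal := by
    filter_upwards [htop] with t ht
    simpa using EReal.toReal_le_toReal (hlt t).le (by simp) ht.ne
  refine ⟨fun t => (g t).toReal, δ, hint, fun a b hab =>
    intervalIntegral.integral_mono_ae hab hφ.intervalIntegrable hint.intervalIntegrable hae,
    fun a b hab => ?_, hδ, ?_⟩
  · have h1 : ∫ t in a..b, ((g t).toReal - φ t) ≤ ∫ t, ((g t).toReal - φ t) := by
      rw [intervalIntegral.integral_of_le hab]
      exact setIntegral_le_integral (hint.sub hφ) (by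
        filter_upwards [hae] with t ht using sub_nonneg.2 ht)
    rw [intervalIntegral.integral_sub hint.intervalIntegrable hφ.intervalIntegrable,
      integral_sub hint hφ] at h1
    linarith
  · intro c d τ h₁ h₂ h₃ h₄
    calc (d - c) * φ τ = ∫ _ in c..d, φ τ := by simp
      _ ≤ ∫ t in c..d, (g t).toReal := by
        refine intervalIntegral.integral_mono_ae_restrict (h₁.trans h₂) (by simp)
          hint.intervalIntegrable ((ae_restrict_iff' measurableSet_Icc).2 ?_)
        filter_upwards [htop] with t ht hm
        have := hδ' τ t (by rw [abs_lt]; constructor <;> linarith [hm.1, hm.2])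
        simpa using EReal.toReal_le_toReal this.le (by simp) ht.ne

theorem HasPerronIntegral.le_integral {g φ : ℝ → ℝ} {a b J : ℝ} (h : HasPerronIntegral g a b J)
    (hφ : Integrable φ) (hle : ∀ t ∈ Icc a b, g t ≤ φ t) : J ≤ ∫ t in a..b, φ t := by
  refine le_of_forall_pos_le_add fun ε hε => ?_
  obtain ⟨u, δ, hu, -, hub, hδ, hud⟩ := exists_majorant hφ (half_pos hε)
  obtain ⟨S, hS, hS'⟩ := h.exists_fineSum hδ (half_pos hε)
  have key : ∀ d S, FineSum g δ a d S → d ≤ b → S ≤ ∫ t in a..d, u t := by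
    intro d S hS
    induction hS with
    | nil => simp
    | @snoc c d τ S hc h₁ h₂ h₃ h₄ ih =>
      intro hd
      have i1 := ih ((h₁.trans h₂).trans hd)
      have i2 := hud c d τ h₁ h₂ h₃ h₄
      have i3 : (d - c) * g τ ≤ (d - c) * φ τ :=
        mul_le_mul_of_nonneg_left (hle τ ⟨hc.le.trans h₁, h₂.trans hd⟩) (by linarith)
      rw [← intervalIntegral.integral_add_adjacent_intervals (b := c) hu.intervalIntegrable
        hu.intervalIntegrable, smul_eq_mul]
      linarith
  have := key b S hS le_rfl
  rw [Real.norm_eq_abs, abs_lt] at hS'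
  linarith [hub a b h.le]

/-- The form of `HasPerronIntegral.le_integral` with a bound that holds almost everywhere. -/
theorem HasPerronIntegral.le_integral_of_ae {g φ : ℝ → ℝ} {a b J : ℝ}
    (h : HasPerronIntegral g a b J) (hφ : Integrable φ)
    (hle : ∀ᵐ t, t ∈ Icc a b → g t ≤ φ t) : J ≤ ∫ t in a..b, φ t := by
  classical
  -- Raising `φ` to `g` on the exceptional null set makes the bound hold everywhere without changing
  -- the integral.
  set ψ : ℝ → ℝ := fun t => if t ∈ Icc a b → g t ≤ φ t then φ t else g t with hψ
  have hae : φ =ᵐ[volume] ψ := by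
    filter_upwards [hle] with t ht
    simp only [hψ, if_pos ht]
  have hi := h.le_integral (hφ.congr hae) (fun t ht => by
    simp only [hψ]
    split_ifs with h'
    · exact h' ht
    · exact le_rfl)
  rwa [← intervalIntegral.integral_congr_ae (hae.mono fun t ht _ => ht)] at hi

/-- A tag `τ` in the bad set makes the error `(d - c) g(τ) - ∫ g` exceed `η (d - c)`, up to the
error of a majorant of `-μ`. Saks-Henstock bounds the sum of these errors, hence the total length of
the intervals covering the bad set. Only outer measure is used, so `g` need not be measurable. -/
theorem measure_setOf_add_lt_eq_zero {g μ : ℝ → ℝ} {a b : ℝ} (hab : a ≤ b)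
    (hg : ∀ c d, a ≤ c → c ≤ d → d ≤ b → PerronIntegrable g c d) (hμ : Integrable μ)
    (hle : ∀ c d J, a ≤ c → c ≤ d → d ≤ b → HasPerronIntegral g c d J → J ≤ ∫ t in c..d, μ t)
    {η : ℝ} (hη : 0 < η) : volume {t | t ∈ Icc a b ∧ μ t + η < g t} = 0 := by
  refine le_antisymm (ENNReal.le_of_forall_pos_le_add fun ε hε _ => ?_) (zero_le)
  have hε' : 0 < (ε : ℝ) * η / 2 := by positivity
  obtain ⟨δ₁, hδ₁, h₁⟩ := exists_gauge_fineError hab hg hε'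
  obtain ⟨u, δ₂, hu, hlb, hub, hδ₂, hud⟩ := exists_majorant hμ.neg hε'
  set δ : ℝ → ℝ := fun t => min (δ₁ t) (δ₂ t) with hδdef
  have hδ : ∀ t, 0 < δ t := fun t => lt_min (hδ₁ t) (hδ₂ t)
  -- On `E k` the gauge is bounded below, so any interval shorter than `1 / (k + 1)` may be tagged
  -- at any of its points in `E k`.
  set E : ℕ → Set ℝ := fun k => {t | (t ∈ Icc a b ∧ μ t + η < g t) ∧ 1 / ((k : ℝ) + 1) < δ t}
    with hE
  have hU : {t | t ∈ Icc a b ∧ μ t + η < g t} = ⋃ k, E k := by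
    ext t
    simp only [hE, mem_iUnion, mem_ofPred_eq, exists_and_left, iff_self_and]
    exact fun _ => exists_nat_one_div_lt (hδ t)
  have hmono : Monotone E := fun k l hkl t ht =>
    ⟨ht.1, (one_div_le_one_div_of_le (by positivity)
      (by exact_mod_cast Nat.succ_le_succ hkl)).trans_lt ht.2⟩
  rw [hU, hmono.measure_iUnion, zero_add]
  refine iSup_le fun k => ?_
  have key : ∃ S L, FineError g δ a b S ∧ 0 ≤ L ∧ volume (E k ∩ Icc a b) ≤ ENNReal.ofReal L ∧
      η * L ≤ S + ∫ t in a..b, (u t + μ t) := by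
    have hsum : Integrable (fun t => u t + μ t) := hu.add hμ
    refine cousin_induction hab (fun c d => ∃ S L, FineError g δ c d S ∧ 0 ≤ L ∧
      volume (E k ∩ Icc c d) ≤ ENNReal.ofReal L ∧ η * L ≤ S + ∫ t in c..d, (u t + μ t)) ?_ ?_
    · rintro r s t - hrs hst - ⟨S, L, hS, hL, hm, hl⟩ ⟨S', L', hS', hL', hm', hl'⟩
      refine ⟨S + S', L + L', hS.append hS', add_nonneg hL hL', ?_, ?_⟩
      · rw [← Icc_union_Icc_eq_Icc hrs hst, inter_union_distrib_left, ENNReal.ofReal_add hL hL']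
        exact (measure_union_le _ _).trans (add_le_add hm hm')
      · rw [← intervalIntegral.integral_add_adjacent_intervals (b := s) hsum.intervalIntegrable
          hsum.intervalIntegrable]
        linarith
    · intro p _
      have hk : 0 < 1 / ((k : ℝ) + 1) := by positivity
      refine ⟨1 / ((k : ℝ) + 1) / 2, half_pos hk, fun s t has hsp hpt htb hs ht => ?_⟩
      have hst := hsp.trans hpt
      rcases (E k ∩ Icc s t).eq_empty_or_nonempty with hem | ⟨τ, hτ, hτs, hτt⟩
      -- Intervals missing `E k` are skipped; they cost nothing because `∫ (u + μ) ≥ 0`.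
      · refine ⟨0, 0, FineError.nil.skip hst, le_rfl, by simp [hem], ?_⟩
        have h0 := hlb s t hst
        simp only [Pi.neg_apply, intervalIntegral.integral_neg] at h0
        rw [intervalIntegral.integral_add hu.intervalIntegrable hμ.intervalIntegrable]
        linarith
      · obtain ⟨J, hJ⟩ := hg s t has hst htb
        have hδτ := hτ.2
        have hm₁ : δ τ ≤ δ₂ τ := min_le_right _ _
        have i1 := hud s t τ hτs hτt (by linarith) (by linarith)
        have i2 := hle s t J has hst htb hJ
        refine ⟨_, t - s, FineError.nil.snoc hτs hτt (by linarith) (by linarith) hJ, by linarith,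
          ?_, ?_⟩
        · exact (measure_mono inter_subset_right).trans (by simp)
        · rw [intervalIntegral.integral_add hu.intervalIntegrable hμ.intervalIntegrable,
            smul_eq_mul]
          have i3 := mul_le_mul_of_nonneg_left hτ.1.2.le (sub_nonneg.2 hst)
          simp only [Pi.neg_apply] at i1
          nlinarith
  obtain ⟨S, L, hS, hL, hm, hl⟩ := key
  have hEk : E k ∩ Icc a b = E k := inter_eq_left.2 fun t ht => ht.1.1
  rw [hEk] at hm
  refine hm.trans (ENNReal.ofReal_le_of_le_toReal ?_)
  have j1 := (abs_le.1 (h₁ S (hS.mono fun t => min_le_left _ _))).2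
  have j2 := hub a b hab
  simp only [Pi.neg_apply, intervalIntegral.integral_neg] at j2
  rw [intervalIntegral.integral_add hu.intervalIntegrable hμ.intervalIntegrable] at hl
  rw [ENNReal.coe_toReal]
  have : η * L ≤ η * ε := by linarith
  exact le_of_mul_le_mul_left this hη

/-- A bound for the integrals over all subintervals is a bound almost everywhere. -/
theorem ae_le_of_integral_le {g μ : ℝ → ℝ} {a b : ℝ} (hab : a ≤ b)
    (hg : ∀ c d, a ≤ c → c ≤ d → d ≤ b → PerronIntegrable g c d) (hμ : Integrable μ)
    (hle : ∀ c d J, a ≤ c → c ≤ d → d ≤ b → HasPerronIntegral g c d J → J ≤ ∫ t in c..d, μ t) :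
    ∀ᵐ t, t ∈ Icc a b → g t ≤ μ t := by
  have h : ∀ n : ℕ, ∀ᵐ t, ¬ (t ∈ Icc a b ∧ μ t + 1 / ((n : ℝ) + 1) < g t) := fun n => by
    rw [ae_iff]
    simpa only [not_not] using measure_setOf_add_lt_eq_zero hab hg hμ hle
      (η := 1 / ((n : ℝ) + 1)) (by positivity)
  filter_upwards [ae_all_iff.2 h] with t ht htm
  by_contra! hlt
  obtain ⟨n, hn⟩ := exists_nat_one_div_lt (sub_pos.2 hlt)
  exact ht n ⟨htm, by linarith⟩

/-! ### Norm bounds for vector-valued integrals -/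

section Vector

variable {X : Type*} [NormedAddCommGroup X] [NormedSpace ℝ X]

theorem HasPerronIntegral.norm_le_integral {h : ℝ → X} {φ : ℝ → ℝ} {a b : ℝ} {J : X}
    (hJ : HasPerronIntegral h a b J) (hφ : Integrable φ) (hle : ∀ t ∈ Icc a b, ‖h t‖ ≤ φ t) :
    ‖J‖ ≤ ∫ t in a..b, φ t := by
  obtain ⟨ℓ, hℓ, hℓJ⟩ := exists_dual_vector'' ℝ J
  have := (hJ.clm ℓ).le_integral hφ fun t ht => by
    refine (le_abs_self _).trans ((ℓ.le_opNorm _).trans ?_)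
    exact (mul_le_of_le_one_left (norm_nonneg _) hℓ).trans (hle t ht)
  rw [hℓJ] at this
  simpa using this

/-- If the integrals of `A` over subintervals are dominated by those of `m`, then those of
`A z` are dominated by those of `N m` whenever `‖z‖ ≤ N` and `z` has separable range. -/
theorem HasPerronIntegral.norm_le_mul_integral {A : ℝ → X →L[ℝ] X} {m : ℝ → ℝ} {z : ℝ → X}
    {a b N : ℝ} {J : X} (hJ : HasPerronIntegral (fun t => A t (z t)) a b J)
    (hA : ∀ c d, a ≤ c → c ≤ d → d ≤ b → PerronIntegrable A c d) (hm : Integrable m)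
    (hm0 : ∀ t, 0 ≤ m t)
    (hAm : ∀ c d J, a ≤ c → c ≤ d → d ≤ b → HasPerronIntegral A c d J → ‖J‖ ≤ ∫ t in c..d, m t)
    (hz : TopologicalSpace.IsSeparable (z '' Icc a b)) (hN : ∀ t ∈ Icc a b, ‖z t‖ ≤ N) :
    ‖J‖ ≤ N * ∫ t in a..b, m t := by
  obtain ⟨ℓ, hℓ, hℓJ⟩ := exists_dual_vector'' ℝ J
  obtain ⟨D, hD, hzD⟩ := hz
  -- The null set depends on `y`, so only countably many `y` can be treated at once; separability of
  -- the range of `z` and closedness of the inequality in `y` then cover every `z t`.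
  have hy : ∀ y ∈ D, ∀ᵐ t, t ∈ Icc a b → ℓ (A t y) ≤ ‖y‖ * m t := by
    intro y _
    set Λ : (X →L[ℝ] X) →L[ℝ] ℝ := ℓ ∘L ContinuousLinearMap.apply ℝ X y with hΛ
    have hΛle : ∀ T, Λ T ≤ ‖y‖ * ‖T‖ := fun T => by
      have h1 : Λ T = ℓ (T y) := rfl
      have h2 := ℓ.le_opNorm (T y)
      have h3 := T.le_opNorm y
      have h4 : ‖ℓ‖ * ‖T y‖ ≤ ‖T y‖ := mul_le_of_le_one_left (norm_nonneg _) hℓ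
      rw [h1]
      linarith [le_abs_self (ℓ (T y)), Real.norm_eq_abs (ℓ (T y)), mul_comm ‖T‖ ‖y‖]
    refine ae_le_of_integral_le (g := fun t => Λ (A t)) hJ.le (fun c d h1 h2 h3 => ?_)
      (hm.const_mul _) (fun c d I h1 h2 h3 hI => ?_)
    · obtain ⟨I, hI⟩ := hA c d h1 h2 h3
      exact ⟨_, hI.clm Λ⟩
    · obtain ⟨I', hI'⟩ := hA c d h1 h2 h3
      rw [hI.unique (hI'.clm Λ), intervalIntegral.integral_const_mul]
      exact (hΛle I').trans (mul_le_mul_of_nonneg_left (hAm c d I' h1 h2 h3 hI') (norm_nonneg _))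
  have hae : ∀ᵐ t, t ∈ Icc a b → ℓ (A t (z t)) ≤ N * m t := by
    filter_upwards [(ae_ball_iff hD).2 hy] with t ht htm
    have hcl : IsClosed {y | ℓ (A t y) ≤ ‖y‖ * m t} :=
      isClosed_le (by fun_prop) (by fun_prop)
    have : z t ∈ {y | ℓ (A t y) ≤ ‖y‖ * m t} :=
      hcl.closure_subset_iff.2 (fun y hyD => ht y hyD htm) (hzD (mem_image_of_mem z htm))
    exact this.trans (mul_le_mul_of_nonneg_right (hN t htm) (hm0 t))
  have := (hJ.clm ℓ).le_integral_of_ae (hm.const_mul N) hae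
  rw [hℓJ, intervalIntegral.integral_const_mul] at this
  simpa using this

end Vector

end ImpulsiveODE

/-! ### Local estimates for the impulsive equation -/

namespace ImpulsiveODE

variable {X : Type*} [NormedAddCommGroup X] [NormedSpace ℝ X]

section Domination

variable {A : ℝ → X →L[ℝ] X} {m : ℝ → ℝ}

theorem intervalIntegrable_abs (hm : LocallyIntegrable m volume) (a b : ℝ) :
    IntervalIntegrable (fun t => |m t|) volume a b :=
  IntegrableOn.intervalIntegrable (hm.integrableOn_isCompact isCompact_uIcc).abs

theorem norm_perronIntegral_le_integral_abs (hm : LocallyIntegrable m volume)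
    (hAm : ∀ c d, c < d → ∀ J, HasPerronIntegral A c d J → ‖J‖ ≤ ∫ s in c..d, m s)
    {c d : ℝ} {J : X →L[ℝ] X} (hJ : HasPerronIntegral A c d J) : ‖J‖ ≤ ∫ s in c..d, |m s| := by
  rcases hJ.le.eq_or_lt with rfl | hlt
  · have : J = 0 := by simpa using hJ.add_adjacent hJ hJ
    simp [this]
  · refine (hAm c d hlt J hJ).trans (intervalIntegral.integral_mono_on hlt.le ?_ ?_
      fun t _ => le_abs_self _)
    · exact (hm.integrableOn_isCompact isCompact_uIcc).intervalIntegrable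
    · exact intervalIntegrable_abs hm c d

theorem HasPerronIntegral.norm_le_mul_integral_abs {z : ℝ → X} {a b N : ℝ} {J : X}
    (hJ : HasPerronIntegral (fun t => A t (z t)) a b J)
    (hA : ∀ c d, c ≤ d → PerronIntegrable A c d) (hm : LocallyIntegrable m volume)
    (hAm : ∀ c d, c < d → ∀ J, HasPerronIntegral A c d J → ‖J‖ ≤ ∫ s in c..d, m s)
    (hz : ContinuousOn z (Icc a b)) (hN : ∀ t ∈ Icc a b, ‖z t‖ ≤ N) :
    ‖J‖ ≤ N * ∫ t in a..b, |m t| := by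
  -- Truncation to `[a, b]` turns the locally integrable `|m|` into an integrable nonnegative bound.
  set n : ℝ → ℝ := (Icc a b).indicator fun t => |m t| with hn
  have hni : Integrable n :=
    (integrable_indicator_iff measurableSet_Icc).2 (hm.integrableOn_isCompact isCompact_Icc).abs
  have hnm : ∀ c d, a ≤ c → c ≤ d → d ≤ b → ∫ t in c..d, n t = ∫ t in c..d, |m t| :=
    fun c d h1 h2 h3 => intervalIntegral.integral_congr fun t ht => by
      rw [uIcc_of_le h2] at ht
      exact indicator_of_mem (mem_Icc.2 ⟨h1.trans ht.1, ht.2.trans h3⟩) _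
  rw [← hnm a b le_rfl hJ.le le_rfl]
  refine hJ.norm_le_mul_integral (fun c d _ h _ => hA c d h) hni
    (fun t => indicator_nonneg (fun _ _ => abs_nonneg _) t) (fun c d I h1 h2 h3 hI => ?_)
    (isCompact_Icc.image_of_continuousOn hz).isSeparable hN
  rw [hnm c d h1 h2 h3]
  exact norm_perronIntegral_le_integral_abs hm hAm hI

theorem continuousOn_of_increments {g h z : ℝ → X} {a b : ℝ}
    (hz : ∀ s t, a ≤ s → s ≤ t → t ≤ b → ∃ J₁ J₂, HasPerronIntegral g s t J₁ ∧
      HasPerronIntegral h s t J₂ ∧ z t = z s + J₁ + J₂) : ContinuousOn z (Icc a b) := by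
  intro p hp
  refine Metric.continuousWithinAt_iff.2 fun ε hε => ?_
  obtain ⟨ρ₁, hρ₁, h₁⟩ := exists_norm_integral_lt (g := g) (fun c d h1 h2 h3 => by
    obtain ⟨J₁, -, hJ, -⟩ := hz c d h1 h2 h3
    exact ⟨J₁, hJ⟩) hp (half_pos hε)
  obtain ⟨ρ₂, hρ₂, h₂⟩ := exists_norm_integral_lt (g := h) (fun c d h1 h2 h3 => by
    obtain ⟨-, J₂, -, hJ, -⟩ := hz c d h1 h2 h3
    exact ⟨J₂, hJ⟩) hp (half_pos hε)
  refine ⟨min ρ₁ ρ₂, lt_min hρ₁ hρ₂, fun {t} ht hd => ?_⟩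
  rw [Real.dist_eq, abs_lt] at hd
  have m1 := min_le_left ρ₁ ρ₂
  have m2 := min_le_right ρ₁ ρ₂
  rw [dist_eq_norm]
  rcases le_total t p with htp | htp
  · obtain ⟨J₁, J₂, hJ₁, hJ₂, e⟩ := hz t p ht.1 htp hp.2
    have e' : z t - z p = -(J₁ + J₂) := by rw [e]; abel
    rw [e', norm_neg]
    linarith [norm_add_le J₁ J₂,
      h₁ t p J₁ ht.1 htp le_rfl hp.2 (by linarith) (by linarith) hJ₁,
      h₂ t p J₂ ht.1 htp le_rfl hp.2 (by linarith) (by linarith) hJ₂]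
  · obtain ⟨J₁, J₂, hJ₁, hJ₂, e⟩ := hz p t hp.1 htp ht.2
    have e' : z t - z p = J₁ + J₂ := by rw [e]; abel
    rw [e']
    linarith [norm_add_le J₁ J₂,
      h₁ p t J₁ hp.1 le_rfl htp ht.2 (by linarith) (by linarith) hJ₁,
      h₂ p t J₂ hp.1 le_rfl htp ht.2 (by linarith) (by linarith) hJ₂]

/-- On short intervals, a solution of `z' = A z + h` that vanishes somewhere is controlled
by `h`. -/
theorem norm_le_of_increments {h z : ℝ → X} {φ : ℝ → ℝ} {a b e : ℝ}
    (hA : ∀ c d, c ≤ d → PerronIntegrable A c d) (hm : LocallyIntegrable m volume)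
    (hAm : ∀ c d, c < d → ∀ J, HasPerronIntegral A c d J → ‖J‖ ≤ ∫ s in c..d, m s)
    (hsmall : ∫ t in a..b, |m t| ≤ 1 / 2) (hφ : Integrable φ) (hh : ∀ t, ‖h t‖ ≤ φ t)
    (hz : ∀ s t, a ≤ s → s ≤ t → t ≤ b → ∃ J₁ J₂,
      HasPerronIntegral (fun r => A r (z r)) s t J₁ ∧ HasPerronIntegral h s t J₂ ∧
      z t = z s + J₁ + J₂) (he : e ∈ Icc a b) (hze : z e = 0) :
    ∀ t ∈ Icc a b, ‖z t‖ ≤ 2 * ∫ r in a..b, φ r := by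
  have hcont := continuousOn_of_increments hz
  obtain ⟨t₀, ht₀, hmax⟩ := isCompact_Icc.exists_isMaxOn ⟨e, he⟩ hcont.norm
  have hN : ∀ t ∈ Icc a b, ‖z t‖ ≤ ‖z t₀‖ := fun t ht => hmax ht
  have hinc : ∀ s t, a ≤ s → s ≤ t → t ≤ b →
      ‖z t - z s‖ ≤ ‖z t₀‖ / 2 + ∫ r in a..b, φ r := by
    intro s t h1 h2 h3
    obtain ⟨J₁, J₂, hJ₁, hJ₂, e'⟩ := hz s t h1 h2 h3
    have b1 := hJ₁.norm_le_mul_integral_abs hA hm hAm (hcont.mono (Icc_subset_Icc h1 h3))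
      (fun r hr => hN r (Icc_subset_Icc h1 h3 hr))
    have b2 := hJ₂.norm_le_integral hφ fun r _ => hh r
    have b3 : ∫ r in s..t, |m r| ≤ ∫ r in a..b, |m r| :=
      intervalIntegral.integral_mono_interval h1 h2 h3 (ae_of_all _ fun _ => abs_nonneg _)
        (intervalIntegrable_abs hm a b)
    have b4 : ∫ r in s..t, φ r ≤ ∫ r in a..b, φ r :=
      intervalIntegral.integral_mono_interval h1 h2 h3
        (ae_of_all _ fun r => (norm_nonneg _).trans (hh r)) hφ.intervalIntegrable
    have b5 : ‖z t₀‖ * ∫ r in s..t, |m r| ≤ ‖z t₀‖ * (1 / 2) :=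
      mul_le_mul_of_nonneg_left (b3.trans hsmall) (norm_nonneg _)
    have e'' : z t - z s = J₁ + J₂ := by rw [e']; abel
    rw [e'']
    linarith [norm_add_le J₁ J₂]
  -- In place of Gronwall: the increment between the zero `e` and the maximum point `t₀` is at most
  -- half the maximum plus `∫ φ`, and the half is absorbed.
  have hfin : ‖z t₀‖ ≤ ‖z t₀‖ / 2 + ∫ r in a..b, φ r := by
    rcases le_total t₀ e with h | h
    · simpa [hze] using hinc t₀ e ht₀.1 h he.2
    · simpa [hze] using hinc e t₀ he.1 h ht₀.2
  intro t ht
  linarith [hN t ht]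

theorem exists_integral_abs_le_half (hm : LocallyIntegrable m volume) (p : ℝ) :
    ∃ ρ > 0, ∀ s t, p - ρ < s → s ≤ t → t < p + ρ → ∫ r in s..t, |m r| ≤ 1 / 2 := by
  have hI := intervalIntegrable_abs hm
  have hc : Continuous fun t => ∫ r in (0 : ℝ)..t, |m r| :=
    intervalIntegral.continuous_primitive hI 0
  obtain ⟨ρ, hρ, h⟩ := Metric.continuousAt_iff.1 (hc.continuousAt (x := p)) (1 / 4) (by norm_num)
  refine ⟨ρ, hρ, fun s t hs hst ht => ?_⟩
  have h1 := h (x := s) (by rw [Real.dist_eq, abs_lt]; constructor <;> linarith)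
  have h2 := h (x := t) (by rw [Real.dist_eq, abs_lt]; constructor <;> linarith)
  rw [Real.dist_eq, abs_lt] at h1 h2
  rw [← intervalIntegral.integral_interval_sub_left (hI 0 t) (hI 0 s)]
  linarith

end Domination

/-- Near each point `p` there is at most the impulse at `p`. -/
theorem IsImpulseSequence.exists_local_jump {θ : ℤ → ℝ} (hθ : IsImpulseSequence θ)
    {B : ℤ → X →L[ℝ] X} (hB : ∀ i, IsUnit (1 + B i)) (p : ℝ) :
    ∃ C : X →L[ℝ] X, IsUnit (1 + C) ∧ ∃ ρ > 0, ∀ (x : ℝ → X) (s t : ℝ), p - ρ < s → s ≤ t →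
      t < p + ρ → ∑ᶠ (i : ℤ) (_ : s ≤ θ i ∧ θ i < t), B i (x (θ i)) =
        if s ≤ p ∧ p < t then C (x p) else 0 := by
  have hfin : {i | p - 1 ≤ θ i ∧ θ i ≤ p + 1}.Finite := by
    obtain ⟨i₁, h₁⟩ := (hθ.tendsto_atTop.eventually_gt_atTop (p + 1)).exists
    obtain ⟨i₂, h₂⟩ := (hθ.tendsto_atBot.eventually_lt_atBot (p - 1)).exists
    refine (finite_Icc i₂ i₁).subset fun i hi => ⟨?_, ?_⟩
    · exact (hθ.strictMono.lt_iff_lt.1 (h₂.trans_le hi.1)).le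
    · exact (hθ.strictMono.lt_iff_lt.1 (hi.2.trans_lt h₁)).le
  have hclosed : IsClosed ((θ '' {i | p - 1 ≤ θ i ∧ θ i ≤ p + 1}) \ {p}) :=
    ((hfin.image θ).subset sdiff_subset).isClosed
  obtain ⟨r, hr, hball⟩ := Metric.isOpen_iff.1 hclosed.isOpen_compl p (by simp)
  have hloc : ∀ i, p - min r 1 < θ i → θ i < p + min r 1 → θ i = p := by
    intro i h1 h2
    by_contra hne
    have m1 := min_le_left r 1
    have m2 := min_le_right r 1
    have hmem : θ i ∈ Metric.ball p r := by
      rw [Metric.mem_ball, Real.dist_eq, abs_lt]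
      constructor <;> linarith
    exact hball hmem ⟨⟨i, ⟨by linarith, by linarith⟩, rfl⟩, hne⟩
  by_cases hp : ∃ i, θ i = p
  · obtain ⟨i₀, hi₀⟩ := hp
    refine ⟨B i₀, hB i₀, min r 1, lt_min hr one_pos, fun x s t hs hst ht => ?_⟩
    rw [finsum_eq_single _ i₀ fun i hi => ?_]
    · rw [finsum_eq_if, hi₀]
    · rw [finsum_eq_if, if_neg]
      rintro ⟨h1, h2⟩
      exact hi (hθ.strictMono.injective ((hloc i (by linarith) (by linarith)).trans hi₀.symm))
  · refine ⟨0, by simp, min r 1, lt_min hr one_pos, fun x s t hs hst ht => ?_⟩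
    have : ∀ i, ∑ᶠ (_ : s ≤ θ i ∧ θ i < t), B i (x (θ i)) = 0 := fun i => by
      rw [finsum_eq_if, if_neg]
      rintro ⟨h1, h2⟩
      exact hp ⟨i, hloc i (by linarith) (by linarith)⟩
    simp [this]

variable {A : ℝ → X →L[ℝ] X} {θ : ℤ → ℝ} {B : ℤ → X →L[ℝ] X} {f : ℝ → X → X} {m φ : ℝ → ℝ}

theorem IsSolution.sub_linear {x y : ℝ → X} (hx : IsSolution A θ B f x)
    (hy : IsLinearSolution A θ B y) {C : X →L[ℝ] X} {p s t : ℝ} (hst : s ≤ t)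
    (hC : ∀ w : ℝ → X, ∑ᶠ (i : ℤ) (_ : s ≤ θ i ∧ θ i < t), B i (w (θ i)) =
        if s ≤ p ∧ p < t then C (w p) else 0) :
    ∃ J₁ J₂, HasPerronIntegral (fun r => A r (x r - y r)) s t J₁ ∧
      HasPerronIntegral (fun r => f r (x r)) s t J₂ ∧
      x t - y t = x s - y s + J₁ + J₂ + if s ≤ p ∧ p < t then C (x p - y p) else 0 := by
  obtain ⟨J₁, J₂, hJ₁, hJ₂, e⟩ := hx s t hst
  obtain ⟨I₁, I₂, hI₁, hI₂, e'⟩ := hy s t hst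
  have hI : I₂ = 0 := hI₂.unique (hasPerronIntegral_zero hst)
  refine ⟨J₁ - I₁, J₂, (hJ₁.sub hI₁).congr fun r => (map_sub _ _ _).symm, hJ₂, ?_⟩
  rw [hC] at e e'
  rw [e, e', hI, map_sub]
  split_ifs <;> abel

/-- On an interval on one side of `p`, an impulse at `p` matters only if `p` is the left end. Going
forward, it acts on `x p - y p = 0`; going backward, it is undone by invertibility of `1 + C`. The
radius `ρ` is independent of the solutions, as Cousin's lemma requires. -/
theorem exists_local_estimates (hθ : IsImpulseSequence θ) (hB : ∀ i, IsUnit (1 + B i))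
    (hA : ∀ c d, c ≤ d → PerronIntegrable A c d) (hm : LocallyIntegrable m volume)
    (hAm : ∀ c d, c < d → ∀ J, HasPerronIntegral A c d J → ‖J‖ ≤ ∫ s in c..d, m s) (p : ℝ) :
    ∃ ρ > 0, ∀ (f : ℝ → X → X) (φ : ℝ → ℝ) (x y : ℝ → X), IsSolution A θ B f x →
      IsLinearSolution A θ B y → Integrable φ → (∀ t, ‖f t (x t)‖ ≤ φ t) →
      ∀ s t, p - ρ < s → s ≤ t → t < p + ρ →
        ((t ≤ p ∨ p ≤ s) → x s = y s → ‖x t - y t‖ ≤ 2 * ∫ r in s..t, φ r) ∧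
        ((t ≤ p ∨ p ≤ s) → f = (fun _ _ => 0) → x t = y t → x s = y s) := by
  obtain ⟨C, hCu, ρ₁, hρ₁, hC⟩ := hθ.exists_local_jump hB p
  obtain ⟨ρ₂, hρ₂, hsmall⟩ := exists_integral_abs_le_half hm p
  refine ⟨min ρ₁ ρ₂, lt_min hρ₁ hρ₂, fun f φ x y hx hy hφ hf => ?_⟩
  have m1 := min_le_left ρ₁ ρ₂
  have m2 := min_le_right ρ₁ ρ₂
  have hsub := fun s t (h1 : p - min ρ₁ ρ₂ < s) (hst : s ≤ t) (h2 : t < p + min ρ₁ ρ₂) =>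
    hx.sub_linear hy hst fun w => hC w s t (by linarith) hst (by linarith)
  have hest : ∀ φ : ℝ → ℝ, Integrable φ → (∀ t, ‖f t (x t)‖ ≤ φ t) →
      ∀ s t e, p - min ρ₁ ρ₂ < s → s ≤ t → t < p + min ρ₁ ρ₂ → e ∈ Icc s t →
      x e = y e → (t ≤ p ∨ p < s ∨ p = s ∧ x p = y p) →
      ∀ r ∈ Icc s t, ‖x r - y r‖ ≤ 2 * ∫ r in s..t, φ r := by
    intro φ hφ hf s t e h1 hst h2 he hxe hcase
    refine norm_le_of_increments (z := fun r => x r - y r) hA hm hAm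
      (hsmall s t (by linarith) hst (by linarith)) hφ hf (fun s' t' h3 h4 h5 => ?_) he
      (sub_eq_zero.2 hxe)
    obtain ⟨J₁, J₂, hJ₁, hJ₂, e'⟩ := hsub s' t' (by linarith) h4 (by linarith)
    refine ⟨J₁, J₂, hJ₁, hJ₂, ?_⟩
    rw [e']
    rcases hcase with h | h | ⟨-, h⟩
    · rw [if_neg fun h' => by linarith [h'.2], add_zero]
    · rw [if_neg fun h' => by linarith [h'.1], add_zero]
    · simp [h]
  intro s t h1 hst h2
  refine ⟨fun hcase hs => ?_, fun hcase hf0 ht => ?_⟩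
  · refine hest φ hφ hf s t s h1 hst h2 (left_mem_Icc.2 hst) hs ?_ t (right_mem_Icc.2 hst)
    rcases hcase with h | h
    · exact .inl h
    · rcases h.eq_or_lt with rfl | h
      · exact .inr (.inr ⟨rfl, hs⟩)
      · exact .inr (.inl h)
  · have hzero : ∀ c, s ≤ c → c ≤ t → (t ≤ p ∨ p < c) → x c = y c := by
      intro c hsc hct hc
      have := hest (fun _ => 0) (integrable_zero _ _ _) (by simp [hf0]) c t t (by linarith) hct h2
        (right_mem_Icc.2 hct) ht (by tauto) c (left_mem_Icc.2 hct)
      simpa [sub_eq_zero] using this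
    rcases hcase with h | h
    · exact hzero s le_rfl hst (.inl h)
    rcases h.eq_or_lt with rfl | h
    swap
    · exact hzero s le_rfl hst (.inr h)
    rcases hst.eq_or_lt with rfl | hlt
    · exact ht
    -- Here `x = y` on `(p, t]`. Over `[p, c]` the equation gives `(1 + C) (x p - y p) = -∫ A (x -
    -- y)`, and the integral tends to 0 as `c` decreases to `p`.
    have hCz : (1 + C) (x p - y p) = 0 := by
      refine norm_le_zero_iff.1 (le_of_forall_pos_le_add fun ε hε => ?_)
      obtain ⟨ρ, hρ, hint⟩ := exists_norm_integral_lt (g := fun r => A r (x r - y r))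
        (fun c d h3 h4 h5 => by
          obtain ⟨J₁, -, hJ, -⟩ := hsub c d (by linarith) h4 (by linarith)
          exact ⟨J₁, hJ⟩) (left_mem_Icc.2 hst) hε
      set c := min t (p + ρ / 2)
      have hct : c ≤ t := min_le_left _ _
      have hcρ : c ≤ p + ρ / 2 := min_le_right _ _
      have hpc : p < c := lt_min hlt (by linarith)
      obtain ⟨J₁, J₂, hJ₁, hJ₂, e⟩ := hsub p c h1 hpc.le (by linarith)
      have hJ₂' : J₂ = 0 := by
        subst hf0
        exact hJ₂.unique (hasPerronIntegral_zero hpc.le)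
      rw [hzero c hpc.le hct (.inr hpc), sub_self, if_pos ⟨le_rfl, hpc⟩, hJ₂', add_zero] at e
      have e' : (1 + C) (x p - y p) = -J₁ := by
        rw [add_apply, one_apply_eq_self]
        exact eq_neg_of_add_eq_zero_left (by rw [e]; abel)
      rw [e', norm_neg, zero_add]
      exact (hint p c J₁ le_rfl le_rfl hpc.le hct (by linarith) (by linarith) hJ₁).le
    obtain ⟨u, hu⟩ := hCu
    have : (↑u⁻¹ * ↑u : X →L[ℝ] X) (x p - y p) = 0 := by
      rw [hu, mul_apply_eq_comp, hCz, map_zero]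
    rw [Units.inv_mul, one_apply_eq_self] at this
    exact sub_eq_zero.1 this

end ImpulsiveODE

/-! ### Evolution operators, dichotomy and bounded solutions -/

namespace ImpulsiveODE

variable {X : Type*} [NormedAddCommGroup X] [NormedSpace ℝ X]
  {A : ℝ → X →L[ℝ] X} {θ : ℤ → ℝ} {B : ℤ → X →L[ℝ] X} {f : ℝ → X → X} {m φ : ℝ → ℝ}

/-- Solutions of the linear impulsive equation are determined by their value at any time. -/
theorem IsLinearSolution.unique (hθ : IsImpulseSequence θ) (hB : ∀ i, IsUnit (1 + B i))
    (hA : ∀ c d, c ≤ d → PerronIntegrable A c d) (hm : LocallyIntegrable m volume)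
    (hAm : ∀ c d, c < d → ∀ J, HasPerronIntegral A c d J → ‖J‖ ≤ ∫ s in c..d, m s)
    {x y : ℝ → X} (hx : IsLinearSolution A θ B x) (hy : IsLinearSolution A θ B y) {s : ℝ}
    (hs : x s = y s) (t : ℝ) : x t = y t := by
  -- An equivalence is transitive, so one use of Cousin's lemma gives uniqueness in both time
  -- directions.
  have key : ∀ a b, a ≤ b → (x a = y a ↔ x b = y b) := by
    intro a b hab
    refine cousin_induction hab (fun s t => x s = y s ↔ x t = y t)
      (fun _ _ _ _ _ _ _ h h' => h.trans h') fun p _ => ?_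
    obtain ⟨ρ, hρ, h⟩ := exists_local_estimates hθ hB hA hm hAm p
    have h' := h _ (fun _ => 0) x y hx hy (integrable_zero _ _ _) (by simp)
    have hloc : ∀ s t, p - ρ < s → s ≤ t → t < p + ρ → (t ≤ p ∨ p ≤ s) →
        (x s = y s ↔ x t = y t) := fun s t h1 h2 h3 hc =>
      ⟨fun e => by simpa [sub_eq_zero] using (h' s t h1 h2 h3).1 hc e,
        fun e => (h' s t h1 h2 h3).2 hc rfl e⟩
    exact ⟨ρ, hρ, fun s t _ hsp hpt _ h1 h2 =>
      (hloc s p h1 hsp (by linarith) (.inl le_rfl)).trans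
        (hloc p t (by linarith) hpt h2 (.inr le_rfl))⟩
  rcases le_total s t with h | h
  · exact (key s t h).1 hs
  · exact (key t s h).2 hs

theorem IsEvolutionOperator.comp (hθ : IsImpulseSequence θ) (hB : ∀ i, IsUnit (1 + B i))
    (hA : ∀ c d, c ≤ d → PerronIntegrable A c d) (hm : LocallyIntegrable m volume)
    (hAm : ∀ c d, c < d → ∀ J, HasPerronIntegral A c d J → ‖J‖ ≤ ∫ s in c..d, m s)
    {W : ℝ → ℝ → X →L[ℝ] X} (hW : IsEvolutionOperator A θ B W) (t s r : ℝ) (ξ : X) :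
    W t s (W s r ξ) = W t r ξ :=
  (hW s (W s r ξ)).2.unique hθ hB hA hm hAm (hW r ξ).2 (hW s (W s r ξ)).1 t

/-- Variation of constants as an estimate: along a solution of the nonlinear equation, an
operator family that is invariant under the evolution of the linear equation changes by at most
the integral of the nonlinearity. -/
theorem norm_sub_le_of_invariant (hθ : IsImpulseSequence θ) (hB : ∀ i, IsUnit (1 + B i))
    (hA : ∀ c d, c ≤ d → PerronIntegrable A c d) (hm : LocallyIntegrable m volume)
    (hAm : ∀ c d, c < d → ∀ J, HasPerronIntegral A c d J → ‖J‖ ≤ ∫ s in c..d, m s)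
    {W : ℝ → ℝ → X →L[ℝ] X} (hW : IsEvolutionOperator A θ B W) {Q : ℝ → X →L[ℝ] X}
    (hQ : ∀ t s ξ, Q t (W t s ξ) = Q s ξ) {x : ℝ → X} (hx : IsSolution A θ B f x)
    (hφ : Integrable φ) (hf : ∀ t, ‖f t (x t)‖ ≤ φ t) {a b K : ℝ} (hab : a ≤ b) (hK : 0 ≤ K)
    (hQK : ∀ t, a < t → t ≤ b → ‖Q t‖ ≤ K) :
    ‖Q b (x b) - Q a (x a)‖ ≤ K * (2 * ∫ r in a..b, φ r) := by
  refine cousin_induction hab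
    (fun s t => ‖Q t (x t) - Q s (x s)‖ ≤ K * (2 * ∫ r in s..t, φ r)) ?_ fun p _ => ?_
  · intro s t u _ _ _ _ h h'
    rw [← intervalIntegral.integral_add_adjacent_intervals (b := t) hφ.intervalIntegrable
      hφ.intervalIntegrable]
    have e : Q u (x u) - Q s (x s) = (Q u (x u) - Q t (x t)) + (Q t (x t) - Q s (x s)) := by abel
    rw [e]
    linarith [norm_add_le (Q u (x u) - Q t (x t)) (Q t (x t) - Q s (x s))]
  · obtain ⟨ρ, hρ, h⟩ := exists_local_estimates hθ hB hA hm hAm p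
    have hloc : ∀ s t, a ≤ s → t ≤ b → p - ρ < s → s ≤ t → t < p + ρ → (t ≤ p ∨ p ≤ s) →
        ‖Q t (x t) - Q s (x s)‖ ≤ K * (2 * ∫ r in s..t, φ r) := by
      intro s t has htb h1 hst h2 hc
      -- The case `s = t` is separate because `Q a` has no assumed bound: the unstable dichotomy
      -- estimate excludes equal times.
      rcases hst.eq_or_lt with rfl | hlt
      · simp
      have hd := (h f φ x (fun r => W r s (x s)) hx (hW s (x s)).2 hφ hf s t h1 hst h2).1 hc
        (hW s (x s)).1.symm
      -- By invariance the increment is `Q t` applied to `x t - W t s (x s)`, the deviation from the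
      -- linear solution.
      rw [← hQ t s (x s), ← map_sub]
      exact ((Q t).le_opNorm _).trans (mul_le_mul (hQK t (by linarith) htb) hd
        (norm_nonneg _) hK)
    refine ⟨ρ, hρ, fun s t has hsp hpt htb h1 h2 => ?_⟩
    have e : Q t (x t) - Q s (x s) = (Q t (x t) - Q p (x p)) + (Q p (x p) - Q s (x s)) := by abel
    rw [← intervalIntegral.integral_add_adjacent_intervals (b := p) hφ.intervalIntegrable
      hφ.intervalIntegrable, e]
    have i1 := hloc s p has (by linarith) h1 hsp (by linarith) (.inl le_rfl)
    have i2 := hloc p t (by linarith) htb (by linarith) hpt h2 (.inr le_rfl)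
    linarith [norm_add_le (Q t (x t) - Q p (x p)) (Q p (x p) - Q s (x s))]

/-- The bound `M` only kills the far end, where it is multiplied by `K e^{-αr}` with `r → ∞`; hence
it is absent from the conclusion. The constant 4 is the local factor 2, once for `P` and once for `I
- P`. -/
theorem norm_le_of_bounded_solution (hθ : IsImpulseSequence θ) (hB : ∀ i, IsUnit (1 + B i))
    (hA : ∀ c d, c ≤ d → PerronIntegrable A c d) (hm : LocallyIntegrable m volume)
    (hAm : ∀ c d, c < d → ∀ J, HasPerronIntegral A c d J → ‖J‖ ≤ ∫ s in c..d, m s)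
    {P : X →L[ℝ] X} {K α M : ℝ} (hD : HasExponentialDichotomy A θ B P K α) {x : ℝ → X}
    (hx : IsSolution A θ B f x) (hφ : Integrable φ) (hf : ∀ t, ‖f t (x t)‖ ≤ φ t)
    (hM : ∀ t, ‖x t‖ ≤ M) (t : ℝ) : ‖x t‖ ≤ 4 * K * ∫ r, φ r := by
  obtain ⟨hK, hα, -, W, hW, hP, hI⟩ := hD
  have hcomp := hW.comp hθ hB hA hm hAm
  have hφ0 : ∀ r, 0 ≤ φ r := fun r => (norm_nonneg _).trans (hf r)
  have hint : ∀ a b, a ≤ b → ∫ r in a..b, φ r ≤ ∫ r, φ r := fun a b hab => by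
    rw [intervalIntegral.integral_of_le hab]
    exact setIntegral_le_integral hφ (ae_of_all _ hφ0)
  have hM0 : 0 ≤ M := (norm_nonneg _).trans (hM 0)
  have hQ : ∀ (R : X →L[ℝ] X) (s r : ℝ) (ξ : X),
      (W t 0 ∘L R ∘L W 0 s) (W s r ξ) = (W t 0 ∘L R ∘L W 0 r) ξ := fun R s r ξ => by
    simp [hcomp]
  have hdecay : Tendsto (fun r => K * Real.exp (-α * r) * M) atTop (𝓝 0) := by
    have h1 : Tendsto (fun r => -α * r) atTop atBot :=
      tendsto_id.const_mul_atTop_of_neg (neg_lt_zero.2 hα)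
    simpa using ((Real.tendsto_exp_atBot.comp h1).const_mul K).mul_const M
  have hbound : ∀ r : ℝ, 0 ≤ r → K * Real.exp (-α * r) ≤ K := fun r hr =>
    mul_le_of_le_one_right hK.le (Real.exp_le_one_iff.2 (by nlinarith))
  have hstable : ‖(W t 0 ∘L P ∘L W 0 t) (x t)‖ ≤ K * (2 * ∫ r, φ r) := by
    refine ge_of_tendsto (f := fun r => K * Real.exp (-α * r) * M + K * (2 * ∫ r, φ r))
      (by simpa using hdecay.add_const (K * (2 * ∫ r, φ r))) ?_
    filter_upwards [eventually_ge_atTop 0] with r hr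
    have h1 := norm_sub_le_of_invariant (Q := fun s => W t 0 ∘L P ∘L W 0 s) hθ hB hA hm hAm hW
      (hQ P) hx hφ hf (a := t - r) (b := t) (by linarith) hK.le
      (fun s _ hs => (hP t s hs).trans (hbound _ (sub_nonneg.2 hs)))
    have h2 : ‖(W t 0 ∘L P ∘L W 0 (t - r)) (x (t - r))‖ ≤ K * Real.exp (-α * r) * M := by
      have := hP t (t - r) (by linarith)
      rw [sub_sub_cancel] at this
      exact (ContinuousLinearMap.le_opNorm _ _).trans
        (mul_le_mul this (hM _) (norm_nonneg _) (by positivity))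
    have h3 := mul_le_mul_of_nonneg_left (hint (t - r) t (by linarith)) hK.le
    have h4 := norm_le_norm_add_norm_sub ((W t 0 ∘L P ∘L W 0 (t - r)) (x (t - r)))
      ((W t 0 ∘L P ∘L W 0 t) (x t))
    rw [norm_sub_rev] at h4
    linarith
  set P' : X →L[ℝ] X := ContinuousLinearMap.id ℝ X - P with hP'
  have hunstable : ‖(W t 0 ∘L P' ∘L W 0 t) (x t)‖ ≤ K * (2 * ∫ r, φ r) := by
    refine ge_of_tendsto (f := fun r => K * Real.exp (-α * r) * M + K * (2 * ∫ r, φ r))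
      (by simpa using hdecay.add_const (K * (2 * ∫ r, φ r))) ?_
    filter_upwards [eventually_gt_atTop 0] with r hr
    have h1 := norm_sub_le_of_invariant (Q := fun s => W t 0 ∘L P' ∘L W 0 s) hθ hB hA hm hAm hW
      (hQ P') hx hφ hf (a := t) (b := t + r) (by linarith) hK.le
      (fun s hs _ => (hI t s hs).trans (by
        rw [show α * (t - s) = -α * (s - t) by ring]
        exact hbound _ (sub_nonneg.2 hs.le)))
    have h2 : ‖(W t 0 ∘L P' ∘L W 0 (t + r)) (x (t + r))‖ ≤ K * Real.exp (-α * r) * M := by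
      have := hI t (t + r) (by linarith)
      rw [show α * (t - (t + r)) = -α * r by ring] at this
      exact (ContinuousLinearMap.le_opNorm _ _).trans
        (mul_le_mul this (hM _) (norm_nonneg _) (by positivity))
    have h3 := mul_le_mul_of_nonneg_left (hint t (t + r) (by linarith)) hK.le
    have h4 := norm_le_norm_add_norm_sub ((W t 0 ∘L P' ∘L W 0 (t + r)) (x (t + r)))
      ((W t 0 ∘L P' ∘L W 0 t) (x t))
    linarith
  have hsum : x t = (W t 0 ∘L P ∘L W 0 t) (x t) + (W t 0 ∘L P' ∘L W 0 t) (x t) := by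
    have h1 : W t 0 (W 0 t (x t)) = x t := (hcomp t 0 t (x t)).trans (hW t (x t)).1
    simp [hP', h1]
  rw [hsum]
  linarith [norm_add_le ((W t 0 ∘L P ∘L W 0 t) (x t)) ((W t 0 ∘L P' ∘L W 0 t) (x t))]

theorem isSolution_zero (hf : ∀ t, f t 0 = 0) : IsSolution A θ B f fun _ => 0 := by
  intro s t hst
  exact ⟨0, 0, (hasPerronIntegral_zero hst).congr fun r => (map_zero _).symm,
    (hasPerronIntegral_zero hst).congr fun r => (hf r).symm, by simp⟩

end ImpulsiveODE

theorem theorem6p11 (K : ℝ) :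
    ∃ δ : ℝ, 0 < δ ∧
      ∀ (X : Type*) [NormedAddCommGroup X] [NormedSpace ℝ X] [CompleteSpace X]
        (A : ℝ → X →L[ℝ] X) (θ : ℤ → ℝ) (B : ℤ → X →L[ℝ] X) (f : ℝ → X → X)
        (P : X →L[ℝ] X) (α C : ℝ) (γ : ℝ → ℝ),
        ImpulsiveODE.IsImpulseSequence θ →
        -- `A` is Perron integrable on compact intervals, with integrals dominated by those of a
        -- locally integrable function
        (∀ c d, c ≤ d → ImpulsiveODE.PerronIntegrable A c d) →
        (∃ m : ℝ → ℝ, LocallyIntegrable m volume ∧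
          ∀ c d, c < d → ∀ J, ImpulsiveODE.HasPerronIntegral A c d J → ‖J‖ ≤ ∫ s in c..d, m s) →
        ImpulsiveODE.HasExponentialDichotomy A θ B P K α →
        -- summable impulses and uniformly bounded inverses
        (Summable fun i => ‖B i‖) → ∑' i, ‖B i‖ ≤ C →
        (∀ i, IsUnit (1 + B i) ∧ ‖Ring.inverse (1 + B i)‖ ≤ C) →
        -- the integral of `A` over the line
        (∃ m : ℝ → ℝ, Integrable m volume ∧
          ∃ J, ImpulsiveODE.HasPerronIntegralReal A J ∧ ‖J‖ ≤ ∫ s, m s) →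
        -- the nonlinearity
        (∀ x c d, c ≤ d → ImpulsiveODE.PerronIntegrable (fun t => f t x) c d) →
        (∀ t, f t 0 = 0) →
        Integrable γ volume →
        (∀ t x, ‖f t x‖ ≤ γ t) →
        (∀ t x y, ‖f t x - f t y‖ ≤ γ t * ‖x - y‖) →
        ∫ s, γ s < δ →
        ∃! x : ℝ → X, ImpulsiveODE.IsSolution A θ B f x ∧ ∃ M : ℝ, ∀ t, ‖x t‖ ≤ M := by
  -- This gives `4 K ∫ γ < 1`; the absolute value keeps `δ` positive also for `K ≤ 0`, where no
  -- dichotomy exists.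
  refine ⟨1 / (4 * |K| + 1), by positivity, ?_⟩
  intro X _ _ _ A θ B f P α C γ hθ hA ⟨m, hm, hAm⟩ hD _ _ hB _ _ hf0 hγ hfγ hfL hsmall
  refine ⟨fun _ => 0, ⟨ImpulsiveODE.isSolution_zero hf0, 0, by simp⟩, ?_⟩
  rintro x ⟨hx, M, hM⟩
  have hK : 0 < K := hD.1
  have hγ0 : ∀ t, 0 ≤ γ t := fun t => (norm_nonneg _).trans (hfγ t 0)
  have hbdd : BddAbove (Set.range fun t => ‖x t‖) := ⟨M, by rintro _ ⟨t, rfl⟩; exact hM t⟩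
  set N := ⨆ t, ‖x t‖
  have hN : ∀ t, ‖x t‖ ≤ N := fun t => le_ciSup hbdd t
  -- The Lipschitz bound against `0` gives the majorant `γ N`, which makes the estimate homogeneous
  -- in `N`.
  have hest := fun t => ImpulsiveODE.norm_le_of_bounded_solution (φ := fun t => γ t * N) hθ
    (fun i => (hB i).1) hA hm hAm hD hx (hγ.mul_const N) (fun t => by
      have := hfL t (x t) 0
      rw [hf0, sub_zero, sub_zero] at this
      exact this.trans (mul_le_mul_of_nonneg_left (hN t) (hγ0 t))) hM t
  have hNle : N ≤ 4 * K * ((∫ s, γ s) * N) := by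
    rw [← integral_mul_const]
    exact ciSup_le hest
  have hN0 : 0 ≤ N := (norm_nonneg _).trans (hN 0)
  rw [abs_of_pos hK, lt_div_iff₀ (by positivity)] at hsmall
  have hγi : 0 ≤ ∫ s, γ s := integral_nonneg hγ0
  have hlt : 4 * K * ∫ s, γ s < 1 := by nlinarith
  have hNz : N ≤ 0 := by nlinarith
  funext t
  exact norm_le_zero_iff.1 ((hN t).trans hNz)
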